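/- Let $\mathsf Z$ be a metric space with a Markov transition kernel $Q$ on its Borel sets, let $\rho<\gamma<1$ and $\theta=(1-\gamma)/(1-\rho)\in(0,1)$, and let $d,p,\beta:\mathsf Z\to\mathbb R$ satisfy $p>0$, $\beta\ge 0$ and $d+p\ge 0$ (the last holds in particular if $d\ge 0$). Put $\mathsf X=\mathsf A=[0,1]$ and $\mathsf S=\mathsf X\times\mathsf Z$. For a metric space $\mathsf Y$, write $bm\mathsf Y$ and $bc\mathsf Y$ for the bounded Borel measurable and the bounded continuous real functions on $\mathsf Y$, with the supremum norm. The Epstein–Zin asset-holding problem with discount shocks, in the transformed variable $\tilde v=v^{1-\gamma}$, is the dynamic program $\mathcal D$ with candidate value functions $\mathcal V=bm\mathsf S$, feasible correspondence $$\Gamma(x,z)=\Big\{a: 0\le a\le\min\Big[1,\frac{d(z)x+p(z)x}{p(z)}\Big]\Big\},$$ and aggregator $$H(x,z,a,v)=\Big\{F(x,z,a)^{1-\rho}+\beta(z)\Big[\int v(a,z')\,Q(z,dz')\Big]_+^{1/\theta}\Big\}^{\theta},\qquad F(x,z,a)=d(z)x+p(z)(x-a),$$ where $[s]_+=\max(s,0)$,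 so that $[\cdot]_+$ has no effect when $v\ge 0$. Let $\Sigma$ be the set of Borel maps $\sigma:\mathsf S\to\mathsf A$ with $\sigma(x,z)\in\Gamma(x,z)$ everywhere. Let $(T_\sigma v)(x,z)=H(x,z,\sigma(x,z),v)$ and $(Tv)(x,z)=\sup_{a\in\Gamma(x,z)}H(x,z,a,v)$. Let $v_\sigma=\lim_n T_\sigma^n v_0$ pointwise, well defined if the limit exists and is the same for all $v_0\in\mathcal V$. Let $v^*=\sup_{\sigma\in\Sigma}v_\sigma$, well defined if every $v_\sigma$ is and this supremum is finite at every point. A policy $\sigma\in\Sigma$ is optimal if $v_\sigma=v^*$. A self-map of a metric space is eventually contracting if one of its iterates (of order $n\ge1$) is a contraction. Suppose that (i) $d$, $p$ and $\beta$ are bounded and continuous, (ii) $r(L_\theta)<1$, where $L_\theta: bm\mathsf Z\to bm\mathsf Z$, $L_\theta h(z)=\beta(z)^\theta\int h(z')\,Q(z,dz')$, and $r(L)=\lim_n\|L^n\|^{1/n}$, and (iii) $Q$ is Feller, that is, $z\mapsto\int h(z')\,Q(z,dz')$ is in $bc\mathsf Z$ for every $h\in bc\mathsf Z$. Then: 1.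 $\mathcal D$ is regular: $\mathcal V=bm\mathsf S$; $\Gamma$ is continuous (upper and lower hemicontinuous), nonempty and compact valued; and, on the graph of $\Gamma$, $(x,z,a)\mapsto H(x,z,a,v)$ is measurable for all $v\in bm\mathsf S$, continuous for all $v\in bc\mathsf S$, and bounded for at least one $v\in bc\mathsf S$. 2. Monotonicity holds: if $v,w\in\mathcal V$ and $v\le w$, then $H(x,z,a,v)\le H(x,z,a,w)$ for all $(x,z)\in\mathsf S$ and $a\in\Gamma(x,z)$. 3. Long-run contractivity holds: there is a nonnegative $b\in bm\mathsf Z$ with $|H(x,z,a,v)-H(x,z,a,w)|\le b(z)\int\sup_{x'\in\mathsf X}|v(x',z')-w(x',z')|\,Q(z,dz')$ for all $v,w\in\mathcal V$, $(x,z)\in\mathsf S$, $a\in\Gamma(x,z)$, and such that the operator $L_b h(z)=b(z)\int h(z')\,Q(z,dz')$ on $bm\mathsf Z$ has $r(L_b)<1$. 4. For each $\sigma\in\Sigma$, $T_\sigma$ is eventually contracting on $bm\mathsf S$; and $T$ is eventually contracting on $bc\mathsf S$. 5. For each $\sigma\in\Sigma$, $v_\sigma$ is a well defined, nonnegative element of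 $bm\mathsf S$. 6. $v^*$ is well defined, nonnegative, bounded and continuous, and is the unique fixed point of $T$ in $bc\mathsf S$. 7. At least one optimal policy exists. 8. A policy $\sigma\in\Sigma$ is optimal if and only if $\sigma(x,z)\in\operatorname{argmax}_{a\in\Gamma(x,z)}H(x,z,a,v^*)$ for each $(x,z)\in\mathsf S$. 9. If $\sigma_0,\sigma_1,\dots$ in $\Sigma$ satisfy $T_{\sigma_k}v_{\sigma_{k-1}}=Tv_{\sigma_{k-1}}$ for all $k\ge1$ (Howard's policy iteration), then $v_{\sigma_k}\to v^*$ uniformly. -/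

import Mathlib

open MeasureTheory ProbabilityTheory Set Filter Topology
open scoped ENNReal

noncomputable section

/-! ### Function spaces -/

/-- The bounded measurable real functions on `Y`. -/
def bm (Y : Type*) [MeasurableSpace Y] : Set (Y → ℝ) :=
  {f | Measurable f ∧ ∃ C : ℝ, ∀ y, |f y| ≤ C}

/-- The bounded continuous real functions on `Y`. -/
def bc (Y : Type*) [TopologicalSpace Y] : Set (Y → ℝ) :=
  {f | Continuous f ∧ ∃ C : ℝ, ∀ y, |f y| ≤ C}

/-- The supremum distance of two bounded functions. -/
def supDist {Y : Type*} (v w : Y → ℝ) : ℝ := ⨆ y, |v y - w y|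

/-- `M` is an eventually contracting self-map of the set `C` of bounded functions with the
supremum distance: some iterate of it is a contraction. -/
def EventuallyContractingOn {Y : Type*} (M : (Y → ℝ) → (Y → ℝ)) (C : Set (Y → ℝ)) : Prop :=
  MapsTo M C C ∧ ∃ n : ℕ, 0 < n ∧ ∃ l : ℝ, 0 ≤ l ∧ l < 1 ∧
    ∀ v ∈ C, ∀ w ∈ C, supDist (M^[n] v) (M^[n] w) ≤ l * supDist v w

/-- The bounded measurable functions on `Z` as a normed space with the supremum norm: the
measurable members of the space of all bounded functions. -/
def BM (Z : Type*) [MeasurableSpace Z] : Submodule ℝ (lp (fun _ : Z => ℝ) ∞) where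
  carrier := {f | Measurable (f : Z → ℝ)}
  add_mem' := fun {_ _} hf hg => Measurable.add hf hg
  zero_mem' := (measurable_const : Measurable fun _ : Z => (0 : ℝ))
  smul_mem' := fun c _ hf => Measurable.const_smul hf c

/-- A bounded measurable function as an element of `BM Z`. -/
def BM.mk {Z : Type*} [MeasurableSpace Z] (f : Z → ℝ) (hf : f ∈ bm Z) : BM Z :=
  ⟨⟨f, memℓp_infty (by
    obtain ⟨C, hC⟩ := hf.2
    exact ⟨C, by rintro _ ⟨z, rfl⟩; exact hC z⟩)⟩, hf.1⟩

lemma BM.mem_bm {Z : Type*} [MeasurableSpace Z] (h : BM Z) : (h.1 : Z → ℝ) ∈ bm Z :=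
  ⟨h.2, ‖h‖, fun z => lp.norm_apply_le_norm (by simp) h.1 z⟩

lemma BM.integrable {Z : Type*} [MeasurableSpace Z] (h : BM Z) (μ : Measure Z)
    [IsFiniteMeasure μ] : Integrable (h.1 : Z → ℝ) μ :=
  Integrable.of_bound h.2.aestronglyMeasurable ‖h‖
    (Eventually.of_forall fun z => lp.norm_apply_le_norm (by simp) h.1 z)

lemma BM.abs_integral_le {Z : Type*} [MeasurableSpace Z] (h : BM Z) (μ : Measure Z)
    [IsProbabilityMeasure μ] : |∫ z, h.1 z ∂μ| ≤ ‖h‖ := by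
  have := norm_integral_le_of_norm_le_const (μ := μ) (f := fun z => h.1 z) (C := ‖h‖)
    (Eventually.of_forall fun z => lp.norm_apply_le_norm (by simp) h.1 z)
  simpa using this

lemma mul_integral_mem_bm {Z : Type*} [MeasurableSpace Z] (Q : Kernel Z Z) [IsMarkovKernel Q]
    {b : Z → ℝ} (hb : b ∈ bm Z) (h : BM Z) :
    (fun z => b z * ∫ z', h.1 z' ∂(Q z)) ∈ bm Z := by
  obtain ⟨C, hC⟩ := hb.2
  refine ⟨hb.1.mul (StronglyMeasurable.integral_kernel
    (Measurable.stronglyMeasurable h.2)).measurable, C * ‖h‖, fun z => ?_⟩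
  rw [abs_mul]
  exact mul_le_mul (hC z) (BM.abs_integral_le h (Q z)) (abs_nonneg _)
    ((abs_nonneg _).trans (hC z))

/-- The bounded linear operator `(L h)(z) = b(z) ∫ h(z') Q(z, dz')` on the bounded measurable
functions. -/
def discountOp {Z : Type*} [MeasurableSpace Z] (Q : Kernel Z Z) [IsMarkovKernel Q]
    (b : Z → ℝ) (hb : b ∈ bm Z) : BM Z →L[ℝ] BM Z :=
  LinearMap.mkContinuousOfExistsBound
    { toFun := fun h => BM.mk (fun z => b z * ∫ z', h.1 z' ∂(Q z)) (mul_integral_mem_bm Q hb h)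
      map_add' := by
        intro f g
        apply Subtype.ext
        apply lp.ext
        funext z
        change b z * ∫ z', (f.1 z' + g.1 z') ∂(Q z) =
          b z * ∫ z', f.1 z' ∂(Q z) + b z * ∫ z', g.1 z' ∂(Q z)
        rw [integral_add (BM.integrable f _) (BM.integrable g _), mul_add]
      map_smul' := by
        intro c f
        apply Subtype.ext
        apply lp.ext
        funext z
        change b z * ∫ z', c * f.1 z' ∂(Q z) = c * (b z * ∫ z', f.1 z' ∂(Q z))
        rw [integral_const_mul, mul_left_comm] }
    (by
      obtain ⟨C, hC⟩ := hb.2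
      refine ⟨|C|, fun h => lp.norm_le_of_forall_le (by positivity) fun z => ?_⟩
      change |b z * ∫ z', h.1 z' ∂(Q z)| ≤ |C| * ‖h‖
      rw [abs_mul]
      exact mul_le_mul ((hC z).trans (le_abs_self C)) (BM.abs_integral_le h (Q z))
        (abs_nonneg _) (abs_nonneg _))

/-- `r` is the spectral radius `lim ‖L ^ n‖ ^ (1 / n)` of `L`. -/
def HasSpectralRadius {E : Type*} [NormedAddCommGroup E] [NormedSpace ℝ E] (L : E →L[ℝ] E)
    (r : ℝ) : Prop :=
  Tendsto (fun n : ℕ => ‖L ^ n‖ ^ (1 / (n : ℝ))) atTop (𝓝 r)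

/-- The Feller property of a transition kernel. -/
def Feller {Z : Type*} [TopologicalSpace Z] [MeasurableSpace Z] (Q : Kernel Z Z) : Prop :=
  ∀ h ∈ bc Z, (fun z => ∫ z', h z' ∂(Q z)) ∈ bc Z

/-! ### Dynamic programs -/

/-- A dynamic program with endogenous states `X`, exogenous states `Z` and actions `A`: a feasible
correspondence, a continuation aggregator and a nonempty set of measurable candidate value
functions on `X × Z`. Measurability is Borel measurability throughout. Only the values `H s a v`
with `a ∈ Γ s` and `v ∈ V` are ever used. -/
structure DynamicProgram (X Z A : Type*)
    [MetricSpace X] [MeasurableSpace X] [BorelSpace X]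
    [MetricSpace Z] [MeasurableSpace Z] [BorelSpace Z] [BorelSpace (X × Z)]
    [MetricSpace A] [TopologicalSpace.SeparableSpace A] [MeasurableSpace A] [BorelSpace A] where
  Γ : X × Z → Set A
  H : X × Z → A → (X × Z → ℝ) → ℝ
  V : Set (X × Z → ℝ)
  V_nonempty : V.Nonempty
  V_measurable : ∀ v ∈ V, Measurable v

namespace DynamicProgram

variable {X Z A : Type*}
  [MetricSpace X] [MeasurableSpace X] [BorelSpace X]
  [MetricSpace Z] [MeasurableSpace Z] [BorelSpace Z] [BorelSpace (X × Z)]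
  [MetricSpace A] [TopologicalSpace.SeparableSpace A] [MeasurableSpace A] [BorelSpace A]

/-- The graph of the feasible correspondence: the feasible state-action pairs. -/
def graph (D : DynamicProgram X Z A) : Set ((X × Z) × A) := {g | g.2 ∈ D.Γ g.1}

/-- The feasible policies. -/
def policies (D : DynamicProgram X Z A) : Set (X × Z → A) :=
  {σ | Measurable σ ∧ ∀ s, σ s ∈ D.Γ s}

/-- The policy operator `T_σ`. -/
def Tpol (D : DynamicProgram X Z A) (σ : X × Z → A) (v : X × Z → ℝ) : X × Z → ℝ :=
  fun s => D.H s (σ s) v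

/-- The Bellman operator `T`. -/
def T (D : DynamicProgram X Z A) (v : X × Z → ℝ) : X × Z → ℝ :=
  fun s => sSup ((fun a => D.H s a v) '' D.Γ s)

/-- `w` is the `σ`-value function: from every candidate `v₀`, the iterates `T_σ^n v₀` converge
pointwise to `w`. -/
def IsPolicyValue (D : DynamicProgram X Z A) (σ : X × Z → A) (w : X × Z → ℝ) : Prop :=
  ∀ v₀ ∈ D.V, ∀ s, Tendsto (fun n : ℕ => ((D.Tpol σ)^[n] v₀) s) atTop (𝓝 (w s))

/-- `vs` is the value function: every feasible policy has a `σ`-value function, and `vs` is their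
pointwise (finite) supremum. -/
def IsValueFunction (D : DynamicProgram X Z A) (vs : X × Z → ℝ) : Prop :=
  (∀ σ ∈ D.policies, ∃ w, D.IsPolicyValue σ w) ∧
    ∀ s, IsLUB {y | ∃ σ ∈ D.policies, ∃ w, D.IsPolicyValue σ w ∧ y = w s} (vs s)

/-- A feasible policy is optimal if its value function is the value function. -/
def IsOptimal (D : DynamicProgram X Z A) (σ : X × Z → A) : Prop :=
  σ ∈ D.policies ∧ ∃ w, D.IsPolicyValue σ w ∧ D.IsValueFunction w

/-- Regular dynamic programs. -/
structure Regular (D : DynamicProgram X Z A) : Prop where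
  candidates : D.V = bm (X × Z)
  upper : UpperHemicontinuous D.Γ
  lower : LowerHemicontinuous D.Γ
  nonempty : ∀ s, (D.Γ s).Nonempty
  compact : ∀ s, IsCompact (D.Γ s)
  measurable : ∀ v ∈ bm (X × Z), Measurable fun g : D.graph => D.H g.1.1 g.1.2 v
  continuous : ∀ v ∈ bc (X × Z), Continuous fun g : D.graph => D.H g.1.1 g.1.2 v
  bounded : ∃ v ∈ bc (X × Z), ∃ C : ℝ, ∀ g : D.graph, |D.H g.1.1 g.1.2 v| ≤ C

/-- Monotonicity of the aggregator. -/
def Monotonicity (D : DynamicProgram X Z A) : Prop :=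
  ∀ v ∈ D.V, ∀ w ∈ D.V, v ≤ w → ∀ s, ∀ a ∈ D.Γ s, D.H s a v ≤ D.H s a w

/-- Long-run contractivity. The integrand, a supremum over `x'`, need not be Borel measurable;
`∫⁻` is the Lebesgue integral of a nonnegative function whenever that is defined, and the lower
integral (so the strongest reading of the inequality) otherwise. -/
def LongRunContractive (D : DynamicProgram X Z A) (Q : Kernel Z Z) [IsMarkovKernel Q] : Prop :=
  ∃ (b : Z → ℝ) (hb : b ∈ bm Z), (∀ z, 0 ≤ b z) ∧
    (∀ v ∈ D.V, ∀ w ∈ D.V, ∀ x z, ∀ a ∈ D.Γ (x, z),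
      ENNReal.ofReal |D.H (x, z) a v - D.H (x, z) a w| ≤
        ENNReal.ofReal (b z) *
          ∫⁻ z', ⨆ x' : X, ENNReal.ofReal |v (x', z') - w (x', z')| ∂(Q z)) ∧
    ∃ r : ℝ, HasSpectralRadius (discountOp Q b hb) r ∧ r < 1

end DynamicProgram

/-! ### The Epstein-Zin asset-holding problem -/

section EpsteinZin

variable {Z : Type*} [MetricSpace Z] [MeasurableSpace Z] [BorelSpace Z]

/-- Consumption `F(x, z, a) = d(z) x + p(z) (x - a)`. -/
def ezConsumption (d p : Z → ℝ) (s : unitInterval × Z) (a : unitInterval) : ℝ :=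
  d s.2 * (s.1 : ℝ) + p s.2 * ((s.1 : ℝ) - (a : ℝ))

/-- The Epstein-Zin dynamic program in the transformed variable `v ^ (1 - γ)`, with asset holdings
in `[0, 1]`. The positive part only serves to define the aggregator on candidates that are
not nonnegative, where the power of the integral is meaningless. -/
def ezProgram (Q : Kernel Z Z) (ρ γ : ℝ) (d p β : Z → ℝ) :
    DynamicProgram unitInterval Z unitInterval where
  Γ := fun s => {a | 0 ≤ (a : ℝ) ∧
    (a : ℝ) ≤ min 1 ((d s.2 * (s.1 : ℝ) + p s.2 * (s.1 : ℝ)) / p s.2)}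
  H := fun s a v =>
    (ezConsumption d p s a ^ (1 - ρ) +
        β s.2 * (max 0 (∫ z', v (a, z') ∂(Q s.2))) ^ (1 / ((1 - γ) / (1 - ρ)))) ^
      ((1 - γ) / (1 - ρ))
  V := bm (unitInterval × Z)
  V_nonempty := ⟨0, measurable_zero, 0, by simp⟩
  V_measurable := fun _ hv => hv.1

/-- A nonnegative power of a bounded continuous nonnegative function is bounded and measurable. -/
lemma rpow_mem_bm {β : Z → ℝ} (hβ : β ∈ bc Z) (hβ0 : ∀ z, 0 ≤ β z) {θ : ℝ} (hθ : 0 ≤ θ) :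
    (fun z => β z ^ θ) ∈ bm Z := by
  obtain ⟨C, hC⟩ := hβ.2
  refine ⟨hβ.1.measurable.pow_const θ, C ^ θ, fun z => ?_⟩
  rw [abs_of_nonneg (Real.rpow_nonneg (hβ0 z) θ)]
  exact Real.rpow_le_rpow (hβ0 z) ((le_abs_self _).trans (hC z)) hθ

lemma theta_nonneg {ρ γ : ℝ} (hργ : ρ < γ) (hγ : γ < 1) : 0 ≤ (1 - γ) / (1 - ρ) :=
  div_nonneg (by linarith) (by linarith)

end EpsteinZin

end

/-! ### Iterates of dominated operators -/

/-! With 1/θ > 1, the map t ↦ (A + B t^(1/θ))^θ is, up to scaling, the ℓ^(1/θ) norm of the vector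
(A^θ, B^θ t). Minkowski's inequality makes it Lipschitz on t ≥ 0 with constant B^θ, whatever A ≥ 0
is (`ces_le_add`). Taking B = β(z) gives long-run contractivity with b = β^θ, so the spectral radius
condition on L_θ is exactly the one required.

If g(z) bounds |v - w|, then L g bounds the distance of the images under T_σ and under T. A spectral
radius below 1 makes the norms of the iterates of L summable, by the root test. This gives fixed
points, their uniqueness and geometric-type convergence in any uniformly closed invariant set of
bounded functions (`DominatedBy.exists_fixedPoint`): bm for T_σ, bc for T.

T preserves bc because the Feller property passes to integrands depending continuously on the action
(`Feller.continuous_integral_prod`) and because Γ(x,z) = [0, m(x,z)] with m continuous. Taking the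
smallest maximizer gives a Borel greedy policy (`exists_measurable_argmax_Iic`).

Let u be the fixed point of T in bc. Since T_σ u ≤ T u = u, monotone iteration gives v_σ ≤ u, while
a policy greedy for u has value u. Hence u = v*. Howard's iterates satisfy T v_{σ_k} ≤ v_{σ_{k+1}} ≤
v*, so they converge at least as fast as the iterates of T are bounded to
(`AggregatorDominated.optimality`). -/

lemma BM.abs_apply_le_norm {Z : Type*} [MeasurableSpace Z] (h : BM Z) (z : Z) :
    |h.1 z| ≤ ‖h‖ :=
  lp.norm_apply_le_norm (by simp) h.1 z

lemma BM.norm_le {Z : Type*} [MeasurableSpace Z] (h : BM Z) {c : ℝ} (hc : 0 ≤ c)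
    (H : ∀ z, |h.1 z| ≤ c) : ‖h‖ ≤ c :=
  lp.norm_le_of_forall_le hc H

/-- A bounded measurable function equal to the constant `c`. -/
noncomputable def BM.const (Z : Type*) [MeasurableSpace Z] (c : ℝ) : BM Z :=
  BM.mk (fun _ => c) ⟨measurable_const, |c|, fun _ => le_rfl⟩

lemma BM.norm_const_le {Z : Type*} [MeasurableSpace Z] {c : ℝ} (hc : 0 ≤ c) :
    ‖BM.const Z c‖ ≤ c :=
  BM.norm_le _ hc fun _ => (abs_of_nonneg hc).le

lemma discountOp_apply {Z : Type*} [MeasurableSpace Z] (Q : Kernel Z Z) [IsMarkovKernel Q]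
    (b : Z → ℝ) (hb : b ∈ bm Z) (h : BM Z) (z : Z) :
    (discountOp Q b hb h).1 z = b z * ∫ z', h.1 z' ∂(Q z) := rfl

lemma bc_subset_bm (Y : Type*) [TopologicalSpace Y] [MeasurableSpace Y] [BorelSpace Y] :
    bc Y ⊆ bm Y :=
  fun _ hf => ⟨hf.1.measurable, hf.2⟩

/-- The iterates of `L` are bounded by a summable sequence `e`. -/
structure SummableIterates {E : Type*} [NormedAddCommGroup E] (L : E → E) (e : ℕ → ℝ) : Prop where
  nonneg : ∀ n, 0 ≤ e n
  summable : Summable e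
  bound : ∀ n h, ‖L^[n] h‖ ≤ e n * ‖h‖

/-- Root test: for r < q < 1, eventually ‖L ^ n‖ ≤ q ^ n. -/
lemma HasSpectralRadius.summableIterates {E : Type*} [NormedAddCommGroup E] [NormedSpace ℝ E]
    {L : E →L[ℝ] E} {r : ℝ} (h : HasSpectralRadius L r) (hr : r < 1) :
    SummableIterates L fun n : ℕ => ‖L ^ n‖ where
  nonneg n := norm_nonneg _
  bound n h := by
    rw [← FunLike.coe_pow_eq_iterate]
    exact (L ^ n).le_opNorm h
  summable := by
    obtain ⟨q, hrq, hq⟩ := exists_between hr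
    have h0 : 0 ≤ r := ge_of_tendsto' h fun n => Real.rpow_nonneg (norm_nonneg _) _
    refine Summable.of_norm_bounded_eventually_nat
      (summable_geometric_of_lt_one (h0.trans hrq.le) hq) ?_
    filter_upwards [h.eventually (gt_mem_nhds hrq), eventually_gt_atTop 0] with n hn hpos
    rw [norm_norm]
    have hn0 : (n : ℝ) ≠ 0 := by positivity
    calc ‖L ^ n‖ = (‖L ^ n‖ ^ (1 / (n : ℝ))) ^ (n : ℝ) := by
          rw [← Real.rpow_mul (norm_nonneg _), one_div_mul_cancel hn0, Real.rpow_one]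
      _ ≤ q ^ (n : ℝ) := by gcongr
      _ = q ^ n := Real.rpow_natCast q n

lemma exists_bound_sub {Y : Type*} {C : Set (Y → ℝ)} (hC : ∀ v ∈ C, ∃ c : ℝ, ∀ s, |v s| ≤ c)
    {v w : Y → ℝ}
    (hv : v ∈ C) (hw : w ∈ C) : ∃ c : ℝ, 0 ≤ c ∧ ∀ s, |v s - w s| ≤ c := by
  obtain ⟨c, hc⟩ := hC v hv
  obtain ⟨c', hc'⟩ := hC w hw
  exact ⟨max 0 (c + c'), le_max_left _ _, fun s =>
    ((abs_sub _ _).trans (add_le_add (hc s) (hc' s))).trans (le_max_right _ _)⟩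

/-- `M` is a self-map of `C` such that a bound `g` (depending on the exogenous state only) for the
distance of two members of `C` gives the bound `L g` for the distance of their images. -/
structure DominatedBy {X Z : Type*} [MeasurableSpace Z] (L : BM Z → BM Z)
    (M : (X × Z → ℝ) → (X × Z → ℝ)) (C : Set (X × Z → ℝ)) : Prop where
  mapsTo : MapsTo M C C
  bound : ∀ v ∈ C, ∀ w ∈ C, ∀ g : BM Z, (∀ s, |v s - w s| ≤ g.1 s.2) →
    ∀ s, |M v s - M w s| ≤ (L g).1 s.2

namespace DominatedBy

variable {X Z : Type*} [MeasurableSpace Z] {L : BM Z → BM Z} {e : ℕ → ℝ}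
  {M : (X × Z → ℝ) → (X × Z → ℝ)} {C : Set (X × Z → ℝ)}

lemma iterate_bound (hM : DominatedBy L M C) {v w : X × Z → ℝ} (hv : v ∈ C) (hw : w ∈ C)
    {g : BM Z} (hg : ∀ s, |v s - w s| ≤ g.1 s.2) (n : ℕ) (s : X × Z) :
    |(M^[n] v) s - (M^[n] w) s| ≤ (L^[n] g).1 s.2 := by
  induction n generalizing s with
  | zero => simpa using hg s
  | succ n ih =>
    rw [Function.iterate_succ_apply', Function.iterate_succ_apply', Function.iterate_succ_apply']
    exact hM.bound _ (hM.mapsTo.iterate n hv) _ (hM.mapsTo.iterate n hw) _ ih s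

lemma iterate_le (hM : DominatedBy L M C) (hL : SummableIterates L e) {v w : X × Z → ℝ}
    (hv : v ∈ C) (hw : w ∈ C) {c : ℝ} (hc : 0 ≤ c) (hg : ∀ s, |v s - w s| ≤ c) (n : ℕ) (s : X × Z) :
    |(M^[n] v) s - (M^[n] w) s| ≤ e n * c :=
  calc |(M^[n] v) s - (M^[n] w) s| ≤ (L^[n] (BM.const Z c)).1 s.2 :=
        hM.iterate_bound hv hw (g := BM.const Z c) hg n s
    _ ≤ ‖L^[n] (BM.const Z c)‖ := (le_abs_self _).trans (BM.abs_apply_le_norm _ _)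
    _ ≤ e n * ‖BM.const Z c‖ := hL.bound _ _
    _ ≤ e n * c := by gcongr; exacts [hL.nonneg n, BM.norm_const_le hc]

lemma eventuallyContractingOn (hM : DominatedBy L M C) (hC : ∀ v ∈ C, ∃ c : ℝ, ∀ s, |v s| ≤ c)
    (hL : SummableIterates L e) : EventuallyContractingOn M C := by
  obtain ⟨n, hn1, hn⟩ := ((eventually_gt_atTop 0).and
    (hL.summable.tendsto_atTop_zero.eventually (gt_mem_nhds one_pos))).exists
  refine ⟨hM.mapsTo, n, hn1, e n, hL.nonneg n, hn, fun v hv w hw => ?_⟩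
  have h0 : 0 ≤ supDist v w := Real.iSup_nonneg fun s => abs_nonneg _
  refine Real.iSup_le (fun s => hM.iterate_le hL hv hw h0 (fun s => ?_) n s)
    (mul_nonneg (hL.nonneg n) h0)
  -- A real supremum over an unbounded family is 0 by default, so `supDist` dominates the pointwise
  -- distances only because v and w are bounded.
  obtain ⟨c, hc⟩ := hC v hv
  obtain ⟨c', hc'⟩ := hC w hw
  refine le_ciSup (f := fun s => |v s - w s|) ⟨c + c', ?_⟩ s
  rintro _ ⟨t, rfl⟩
  exact (abs_sub _ _).trans (add_le_add (hc t) (hc' t))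

lemma tendstoUniformly_iterate (hM : DominatedBy L M C)
    (hC : ∀ v ∈ C, ∃ c : ℝ, ∀ s, |v s| ≤ c) (hL : SummableIterates L e)
    {v w : X × Z → ℝ} (hv : v ∈ C) (hw : w ∈ C) (hMw : M w = w) :
    TendstoUniformly (fun n => M^[n] v) w atTop := by
  obtain ⟨c, hc0, hc⟩ := exists_bound_sub hC hv hw
  rw [Metric.tendstoUniformly_iff]
  intro ε hε
  have h := hL.summable.tendsto_atTop_zero.mul_const c
  rw [zero_mul] at h
  filter_upwards [h.eventually (gt_mem_nhds hε)] with n hn s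
  have := hM.iterate_le hL hv hw hc0 hc n s
  rw [Function.iterate_fixed hMw] at this
  rw [dist_comm]
  exact this.trans_lt hn

/-- The fixed point theorem for dominated operators on uniformly closed sets of bounded
functions. -/
lemma exists_fixedPoint (hM : DominatedBy L M C) (hne : C.Nonempty)
    (hC : ∀ v ∈ C, ∃ c : ℝ, ∀ s, |v s| ≤ c) (hL : SummableIterates L e)
    (hcl : ∀ (u : ℕ → X × Z → ℝ) (w : X × Z → ℝ), (∀ n, u n ∈ C) →
      TendstoUniformly u w atTop → w ∈ C) :
    ∃ w ∈ C, M w = w := by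
  obtain ⟨v, hv⟩ := hne
  obtain ⟨c, hc0, hc⟩ := exists_bound_sub hC hv (hM.mapsTo hv)
  -- Consecutive iterates have summable distances, uniformly in s, so they converge uniformly.
  have hstep (s : X × Z) (n : ℕ) :
      dist ((M^[n] v) s) ((M^[n.succ] v) s) ≤ e n * c := by
    rw [Function.iterate_succ_apply]
    exact hM.iterate_le hL hv (hM.mapsTo hv) hc0 hc n s
  have hsum : Summable fun n : ℕ => e n * c := hL.summable.mul_right c
  choose w hw using fun s =>
    cauchySeq_tendsto_of_complete (cauchySeq_of_dist_le_of_summable _ (hstep s) hsum)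
  have hunif : TendstoUniformly (fun n => M^[n] v) w atTop := by
    rw [Metric.tendstoUniformly_iff]
    intro ε hε
    have h : Tendsto (fun n => ∑' m, e (m + n) * c) atTop (𝓝 0) :=
      tendsto_sum_nat_add fun n => e n * c
    filter_upwards [h.eventually (gt_mem_nhds hε)] with n hn s
    rw [dist_comm]
    refine (dist_le_tsum_of_dist_le_of_tendsto _ (hstep s) hsum (hw s) n).trans_lt ?_
    simpa only [add_comm] using hn
  have hwC : w ∈ C := hcl _ w (fun n => hM.mapsTo.iterate n hv) hunif
  refine ⟨w, hwC, funext fun s => ?_⟩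
  refine tendsto_nhds_unique ?_ ((tendsto_add_atTop_iff_nat 1).2 (hw s))
  rw [Metric.tendsto_atTop]
  intro ε hε
  -- M is Lipschitz with constant `e 1`, hence continuous, which identifies the limit as a fixed
  -- point. The added 1 keeps the divisor positive.
  have hK : 0 < e 1 + 1 := by linarith [hL.nonneg 1]
  obtain ⟨N, hN⟩ := eventually_atTop.1 (Metric.tendstoUniformly_iff.1 hunif _ (div_pos hε hK))
  refine ⟨N, fun n hn => ?_⟩
  have h1 := hM.iterate_le hL (hM.mapsTo.iterate n hv) hwC (div_pos hε hK).le (fun t => by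
    have := hN n hn t
    rw [dist_comm] at this
    exact this.le) 1 s
  rw [Function.iterate_succ_apply']
  refine h1.trans_lt ?_
  rw [mul_div_assoc', div_lt_iff₀ hK]
  nlinarith
end DominatedBy

lemma bm_of_tendstoUniformly {Y : Type*} [MeasurableSpace Y] {u : ℕ → Y → ℝ} {w : Y → ℝ}
    (hu : ∀ n, u n ∈ bm Y) (h : TendstoUniformly u w atTop) : w ∈ bm Y := by
  refine ⟨measurable_of_tendsto_metrizable (fun n => (hu n).1)
    (tendsto_pi_nhds.2 fun y => h.tendsto_at y), ?_⟩
  obtain ⟨n, hn⟩ := (Metric.tendstoUniformly_iff.1 h 1 one_pos).exists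
  obtain ⟨c, hc⟩ := (hu n).2
  refine ⟨1 + c, fun y => ?_⟩
  have h1 := hn y
  rw [Real.dist_eq] at h1
  have h2 := abs_add_le (w y - u n y) (u n y)
  rw [sub_add_cancel] at h2
  linarith [hc y]

lemma bc_of_tendstoUniformly {Y : Type*} [TopologicalSpace Y] [MeasurableSpace Y] [BorelSpace Y]
    {u : ℕ → Y → ℝ} {w : Y → ℝ}
    (hu : ∀ n, u n ∈ bc Y) (h : TendstoUniformly u w atTop) : w ∈ bc Y :=
  ⟨h.continuous (Frequently.of_forall fun n => (hu n).1),
    (bm_of_tendstoUniformly (fun n => bc_subset_bm Y (hu n)) h).2⟩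

/-! ### Dynamic programs with long-run contractivity -/

lemma abs_sSup_image_sub_le {A : Type*} {S : Set A} (hS : S.Nonempty) {f g : A → ℝ} {c : ℝ}
    (hf : BddAbove (f '' S)) (hg : BddAbove (g '' S)) (h : ∀ a ∈ S, |f a - g a| ≤ c) :
    |sSup (f '' S) - sSup (g '' S)| ≤ c := by
  rw [abs_sub_le_iff]
  constructor
  · rw [sub_le_iff_le_add]
    refine csSup_le (hS.image f) ?_
    rintro _ ⟨a, ha, rfl⟩
    linarith [le_csSup hg (mem_image_of_mem g ha), (abs_sub_le_iff.1 (h a ha)).1]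
  · rw [sub_le_iff_le_add]
    refine csSup_le (hS.image g) ?_
    rintro _ ⟨a, ha, rfl⟩
    linarith [le_csSup hf (mem_image_of_mem f ha), (abs_sub_le_iff.1 (h a ha)).2]

namespace DynamicProgram

variable {X Z A : Type*}
  [MetricSpace X] [MeasurableSpace X] [BorelSpace X]
  [MetricSpace Z] [MeasurableSpace Z] [BorelSpace Z] [BorelSpace (X × Z)]
  [MetricSpace A] [TopologicalSpace.SeparableSpace A] [MeasurableSpace A] [BorelSpace A]
  {D : DynamicProgram X Z A}

/-- The pointwise form of long-run contractivity, for an operator `L` on bounds. -/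
def AggregatorDominated (D : DynamicProgram X Z A) (L : BM Z → BM Z) : Prop :=
  ∀ v ∈ bm (X × Z), ∀ w ∈ bm (X × Z), ∀ g : BM Z, (∀ s, |v s - w s| ≤ g.1 s.2) →
    ∀ s, ∀ a ∈ D.Γ s, |D.H s a v - D.H s a w| ≤ (L g).1 s.2

/-- The supremum over x' may fail to be measurable, but it lies below the measurable g, whose lower
integral is an ordinary one. From here on only domination by L matters. -/
lemma LongRunContractive.exists_dominated {Q : Kernel Z Z} [IsMarkovKernel Q]
    (h : D.LongRunContractive Q) (hV : D.V = bm (X × Z)) :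
    ∃ (L : BM Z → BM Z) (e : ℕ → ℝ), D.AggregatorDominated L ∧ SummableIterates L e := by
  obtain ⟨b, hb, hb0, hH, r, hr, hr1⟩ := h
  refine ⟨discountOp Q b hb, _, ?_, hr.summableIterates hr1⟩
  rw [hV] at hH
  rintro v hv w hw g hg ⟨x, z⟩ a ha
  have hg0 : ∀ z', 0 ≤ g.1 z' := fun z' => (abs_nonneg _).trans (hg (x, z'))
  rw [discountOp_apply]
  have hint : 0 ≤ ∫ z', g.1 z' ∂(Q z) := integral_nonneg hg0
  rw [← ENNReal.ofReal_le_ofReal_iff (mul_nonneg (hb0 z) hint), ENNReal.ofReal_mul (hb0 z),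
    ofReal_integral_eq_lintegral_ofReal (BM.integrable g _) (Eventually.of_forall hg0)]
  refine (hH v hv w hw x z a ha).trans ?_
  gcongr with z'
  exact iSup_le fun x' => ENNReal.ofReal_le_ofReal (hg (x', z'))

variable {L : BM Z → BM Z} {e : ℕ → ℝ}

/-- Regularity bounds H at a single u; domination carries the bound to every v, as v - u is bounded.
-/
lemma AggregatorDominated.exists_bound (hL : D.AggregatorDominated L) (hreg : D.Regular)
    {v : X × Z → ℝ} (hv : v ∈ bm (X × Z)) :
    ∃ c : ℝ, ∀ s, ∀ a ∈ D.Γ s, |D.H s a v| ≤ c := by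
  obtain ⟨u, hu, c, hc⟩ := hreg.bounded
  have hu' := bc_subset_bm _ hu
  obtain ⟨k, -, hk⟩ := exists_bound_sub (C := bm (X × Z)) (fun _ hv => hv.2) hv hu'
  refine ⟨‖L (BM.const Z k)‖ + c, fun s a ha => ?_⟩
  have h1 := hL v hv u hu' (BM.const Z k) hk s a ha
  have h2 := hc ⟨(s, a), ha⟩
  have h3 := (le_abs_self _).trans (BM.abs_apply_le_norm (L (BM.const Z k)) s.2)
  have h4 := abs_add_le (D.H s a v - D.H s a u) (D.H s a u)
  rw [sub_add_cancel] at h4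
  linarith

lemma AggregatorDominated.bddAbove (hL : D.AggregatorDominated L) (hreg : D.Regular)
    {v : X × Z → ℝ} (hv : v ∈ bm (X × Z)) (s : X × Z) :
    BddAbove ((fun a => D.H s a v) '' D.Γ s) := by
  obtain ⟨c, hc⟩ := hL.exists_bound hreg hv
  refine ⟨c, ?_⟩
  rintro _ ⟨a, ha, rfl⟩
  exact (le_abs_self _).trans (hc s a ha)

lemma AggregatorDominated.tpol (hL : D.AggregatorDominated L) (hreg : D.Regular)
    {σ : X × Z → A} (hσ : σ ∈ D.policies) : DominatedBy L (D.Tpol σ) (bm (X × Z)) where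
  mapsTo v hv := by
    obtain ⟨c, hc⟩ := hL.exists_bound hreg hv
    exact ⟨(hreg.measurable v hv).comp
      (((measurable_id.prodMk hσ.1).subtype_mk (h := hσ.2)) :
        Measurable fun s => (⟨(s, σ s), hσ.2 s⟩ : D.graph)), c, fun s => hc s _ (hσ.2 s)⟩
  bound v hv w hw g hg s := hL v hv w hw g hg s _ (hσ.2 s)

lemma AggregatorDominated.abs_T_sub_le (hL : D.AggregatorDominated L) (hreg : D.Regular)
    {v w : X × Z → ℝ} (hv : v ∈ bm (X × Z)) (hw : w ∈ bm (X × Z)) {g : BM Z}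
    (hg : ∀ s, |v s - w s| ≤ g.1 s.2) (s : X × Z) : |D.T v s - D.T w s| ≤ (L g).1 s.2 :=
  abs_sSup_image_sub_le (hreg.nonempty s) (hL.bddAbove hreg hv s) (hL.bddAbove hreg hw s)
    (hL v hv w hw g hg s)

lemma AggregatorDominated.dominatedBy_T (hL : D.AggregatorDominated L) (hreg : D.Regular)
    (hT : MapsTo D.T (bc (X × Z)) (bc (X × Z))) : DominatedBy L D.T (bc (X × Z)) where
  mapsTo := hT
  bound _ hv _ hw _ hg := hL.abs_T_sub_le hreg (bc_subset_bm _ hv) (bc_subset_bm _ hw) hg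

/-! ### Values of policies and monotone iteration -/

lemma AggregatorDominated.exists_policyValue (hL : D.AggregatorDominated L) (hreg : D.Regular)
    (hsum : SummableIterates L e) {σ : X × Z → A} (hσ : σ ∈ D.policies) :
    ∃ w ∈ bm (X × Z), D.IsPolicyValue σ w ∧ D.Tpol σ w = w := by
  have hM := hL.tpol hreg hσ
  obtain ⟨w, hw, hfix⟩ := hM.exists_fixedPoint ⟨0, measurable_zero, 0, by simp⟩
    (fun _ hv => hv.2) hsum (fun _ _ => bm_of_tendstoUniformly)
  refine ⟨w, hw, fun v hv s => ?_, hfix⟩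
  rw [hreg.candidates] at hv
  exact (hM.tendstoUniformly_iterate (fun _ hv => hv.2) hsum hv hw hfix).tendsto_at s

lemma IsPolicyValue.unique (hV : D.V.Nonempty) {σ : X × Z → A} {w w' : X × Z → ℝ}
    (hw : D.IsPolicyValue σ w) (hw' : D.IsPolicyValue σ w') : w = w' := by
  obtain ⟨v, hv⟩ := hV
  exact funext fun s => tendsto_nhds_unique (hw v hv s) (hw' v hv s)

lemma AggregatorDominated.policyValue (hL : D.AggregatorDominated L) (hreg : D.Regular)
    (hsum : SummableIterates L e) {σ : X × Z → A} (hσ : σ ∈ D.policies)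
    {w : X × Z → ℝ} (hw : D.IsPolicyValue σ w) : w ∈ bm (X × Z) ∧ D.Tpol σ w = w := by
  obtain ⟨w', h1, h2, h3⟩ := hL.exists_policyValue hreg hsum hσ
  rw [hw.unique D.V_nonempty h2]
  exact ⟨h1, h3⟩

/-- A fixed point of a policy operator is the value of the policy. -/
lemma AggregatorDominated.isPolicyValue_of_fixed (hL : D.AggregatorDominated L)
    (hreg : D.Regular) (hsum : SummableIterates L e) {σ : X × Z → A}
    (hσ : σ ∈ D.policies) {w : X × Z → ℝ} (hw : w ∈ bm (X × Z)) (hfix : D.Tpol σ w = w) :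
    D.IsPolicyValue σ w := by
  intro v hv s
  rw [hreg.candidates] at hv
  exact ((hL.tpol hreg hσ).tendstoUniformly_iterate (fun _ hv => hv.2) hsum hv hw
    hfix).tendsto_at s

lemma Monotonicity.tpol_mono (hmono : D.Monotonicity) (hreg : D.Regular) {σ : X × Z → A}
    (hσ : σ ∈ D.policies) {v w : X × Z → ℝ} (hv : v ∈ bm (X × Z)) (hw : w ∈ bm (X × Z))
    (hvw : v ≤ w) : D.Tpol σ v ≤ D.Tpol σ w := by
  rw [← hreg.candidates] at hv hw
  exact fun s => hmono v hv w hw hvw s _ (hσ.2 s)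

lemma AggregatorDominated.tpol_le_T (hL : D.AggregatorDominated L) (hreg : D.Regular)
    {σ : X × Z → A} (hσ : σ ∈ D.policies) {v : X × Z → ℝ} (hv : v ∈ bm (X × Z)) :
    D.Tpol σ v ≤ D.T v :=
  fun s => le_csSup (hL.bddAbove hreg hv s) (mem_image_of_mem _ (hσ.2 s))

/-- By monotonicity every iterate of T_σ from v stays below v, and so does the limit. -/
lemma AggregatorDominated.policyValue_le (hL : D.AggregatorDominated L) (hmono : D.Monotonicity)
    (hreg : D.Regular) {σ : X × Z → A} (hσ : σ ∈ D.policies) {v w : X × Z → ℝ}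
    (hv : v ∈ bm (X × Z)) (h : D.Tpol σ v ≤ v) (hw : D.IsPolicyValue σ w) : w ≤ v := by
  have hmaps := (hL.tpol hreg hσ).mapsTo
  have hiter (n : ℕ) : (D.Tpol σ)^[n] v ≤ v := by
    induction n with
    | zero => exact le_rfl
    | succ n ih =>
      rw [Function.iterate_succ_apply']
      exact (hmono.tpol_mono hreg hσ (hmaps.iterate n hv) hv ih).trans h
  exact fun s => le_of_tendsto' (hw v (hreg.candidates ▸ hv) s) fun n => hiter n s

/-- The iterates started at T_σ v stay above T_σ v. Policy iteration needs this bound, which is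
sharper than v ≤ w. -/
lemma AggregatorDominated.tpol_le_policyValue (hL : D.AggregatorDominated L)
    (hmono : D.Monotonicity) (hreg : D.Regular) {σ : X × Z → A} (hσ : σ ∈ D.policies)
    {v w : X × Z → ℝ} (hv : v ∈ bm (X × Z)) (h : v ≤ D.Tpol σ v) (hw : D.IsPolicyValue σ w) :
    D.Tpol σ v ≤ w := by
  have hmaps := (hL.tpol hreg hσ).mapsTo
  have hiter (n : ℕ) : D.Tpol σ v ≤ (D.Tpol σ)^[n] (D.Tpol σ v) := by
    induction n with
    | zero => exact le_rfl
    | succ n ih =>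
      rw [Function.iterate_succ_apply']
      exact hmono.tpol_mono hreg hσ hv (hmaps.iterate n (hmaps hv)) (h.trans ih)
  exact fun s => ge_of_tendsto' (hw _ (hreg.candidates ▸ hmaps hv) s) fun n => hiter n s

/-- A policy is greedy for `v` iff it attains the supremum in the Bellman operator. -/
lemma AggregatorDominated.tpol_eq_T_iff (hL : D.AggregatorDominated L) (hreg : D.Regular)
    {σ : X × Z → A} (hσ : σ ∈ D.policies) {v : X × Z → ℝ} (hv : v ∈ bm (X × Z)) :
    D.Tpol σ v = D.T v ↔
      ∀ s, σ s ∈ D.Γ s ∧ IsMaxOn (fun a => D.H s a v) (D.Γ s) (σ s) := by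
  constructor
  · intro h s
    refine ⟨hσ.2 s, fun a ha => ?_⟩
    have h1 : D.H s a v ≤ D.T v s := le_csSup (hL.bddAbove hreg hv s) (mem_image_of_mem _ ha)
    rw [← h] at h1
    exact h1
  · intro h
    refine le_antisymm (hL.tpol_le_T hreg hσ hv) fun s => ?_
    refine csSup_le ((hreg.nonempty s).image _) ?_
    rintro _ ⟨a, ha, rfl⟩
    exact (h s).2 ha

/-- Optimality results for regular dynamic programs with a monotone and long-run contractive
aggregator, given that the Bellman operator preserves continuity and that there are measurable
greedy policies. -/
theorem AggregatorDominated.optimality (hL : D.AggregatorDominated L)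
    (hsum : SummableIterates L e) (hmono : D.Monotonicity) (hreg : D.Regular)
    (hT : MapsTo D.T (bc (X × Z)) (bc (X × Z)))
    (hsel : ∀ v ∈ bc (X × Z), ∃ σ ∈ D.policies, D.Tpol σ v = D.T v) :
    ∃ vs, D.IsValueFunction vs ∧ vs ∈ bc (X × Z) ∧ D.T vs = vs ∧
      (∀ w ∈ bc (X × Z), D.T w = w → w = vs) ∧
      (∃ σ ∈ D.policies, D.IsPolicyValue σ vs) ∧
      (∀ σ ∈ D.policies, D.IsOptimal σ ↔
        ∀ s, σ s ∈ D.Γ s ∧ IsMaxOn (fun a => D.H s a vs) (D.Γ s) (σ s)) ∧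
      (∀ (σ : ℕ → X × Z → A) (w : ℕ → X × Z → ℝ),
        (∀ k, σ k ∈ D.policies) → (∀ k, D.IsPolicyValue (σ k) (w k)) →
        (∀ k, D.Tpol (σ (k + 1)) (w k) = D.T (w k)) →
        TendstoUniformly w vs atTop) := by
  have hTd := hL.dominatedBy_T hreg hT
  obtain ⟨vs, hvs, hfix⟩ := hTd.exists_fixedPoint ⟨0, continuous_zero, 0, by simp⟩
    (fun _ hv => hv.2) hsum (fun _ _ => bc_of_tendstoUniformly)
  have hvsm := bc_subset_bm _ hvs
  obtain ⟨τ, hτ, hτT⟩ := hsel vs hvs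
  have hle {σ : X × Z → A} (hσ : σ ∈ D.policies) {w : X × Z → ℝ} (hw : D.IsPolicyValue σ w) :
      w ≤ vs :=
    hL.policyValue_le hmono hreg hσ hvsm ((hL.tpol_le_T hreg hσ hvsm).trans hfix.le) hw
  have hτv : D.IsPolicyValue τ vs :=
    hL.isPolicyValue_of_fixed hreg hsum hτ hvsm (hτT.trans hfix)
  have hval : D.IsValueFunction vs := by
    refine ⟨fun σ hσ => ?_, fun s => ⟨?_, fun y hy => hy ⟨τ, hτ, vs, hτv, rfl⟩⟩⟩
    · obtain ⟨w, -, hw, -⟩ := hL.exists_policyValue hreg hsum hσ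
      exact ⟨w, hw⟩
    · rintro _ ⟨σ, hσ, w, hw, rfl⟩
      exact hle hσ hw s
  refine ⟨vs, hval, hvs, hfix, fun w hw hwT => ?_, ⟨τ, hτ, hτv⟩, fun σ hσ => ?_,
    fun σ w hσ hw hH => ?_⟩
  -- The iterates from a fixed point w are constant, yet converge to vs.
  · have h1 := hTd.tendstoUniformly_iterate (fun _ hv => hv.2) hsum hw hvs hfix
    funext s
    have h2 := h1.tendsto_at s
    simp only [Function.iterate_fixed hwT] at h2
    exact tendsto_nhds_unique tendsto_const_nhds h2
  -- Optimality and greediness are both equivalent to T_σ vs = vs.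
  · rw [← hL.tpol_eq_T_iff hreg hσ hvsm, hfix]
    constructor
    · rintro ⟨-, w, hw, hwv⟩
      obtain rfl : w = vs := funext fun s => (hwv.2 s).unique (hval.2 s)
      exact (hL.policyValue hreg hsum hσ hw).2
    · intro h
      exact ⟨hσ, vs, hL.isPolicyValue_of_fixed hreg hsum hσ hvsm h, hval⟩
  · have hwm (k : ℕ) : w k ∈ bm (X × Z) := (hL.policyValue hreg hsum (hσ k) (hw k)).1
    -- As w_k = T_{σ_k} w_k ≤ T w_k = T_{σ_{k+1}} w_k, the value of σ_{k+1} is at least T w_k.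
    have hstep (k : ℕ) : D.T (w k) ≤ w (k + 1) := by
      rw [← hH k]
      refine hL.tpol_le_policyValue hmono hreg (hσ (k + 1)) (hwm k) ?_ (hw (k + 1))
      rw [hH k]
      conv_lhs => rw [← (hL.policyValue hreg hsum (hσ k) (hw k)).2]
      exact hL.tpol_le_T hreg (hσ k) (hwm k)
    obtain ⟨c, hc0, hc⟩ := exists_bound_sub (C := bm (X × Z)) (fun _ hv => hv.2)
      hvsm (hwm 0)
    -- From 0 ≤ vs - w_{k+1} ≤ T vs - T w_k, each policy improvement applies L once to the error
    -- bound.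
    have hbound (k : ℕ) : ∀ s, |vs s - w k s| ≤ (L^[k] (BM.const Z c)).1 s.2 := by
      induction k with
      | zero => exact hc
      | succ k ih =>
        intro s
        rw [Function.iterate_succ_apply']
        refine le_trans ?_ (hL.abs_T_sub_le hreg hvsm (hwm k) ih s)
        rw [hfix, abs_of_nonneg (sub_nonneg.2 (hle (hσ (k + 1)) (hw (k + 1)) s))]
        exact (sub_le_sub_left (hstep k s) _).trans (le_abs_self _)
    rw [Metric.tendstoUniformly_iff]
    intro ε hε
    have h := hsum.summable.tendsto_atTop_zero.mul_const c
    rw [zero_mul] at h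
    filter_upwards [h.eventually (gt_mem_nhds hε)] with k hk s
    calc dist (vs s) (w k s) ≤ (L^[k] (BM.const Z c)).1 s.2 := hbound k s
      _ ≤ ‖L^[k] (BM.const Z c)‖ := (le_abs_self _).trans (BM.abs_apply_le_norm _ _)
      _ ≤ e k * ‖BM.const Z c‖ := hsum.bound _ _
      _ ≤ e k * c := by gcongr; exacts [hsum.nonneg k, BM.norm_const_le hc0]
      _ < ε := hk

end DynamicProgram

/-! ### Maximization over an interval with a continuous endpoint -/

/-- Parametrizing [0, m] by the fixed compact interval turns a moving constraint set into a moving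
integrand t ↦ f(t m). Hemicontinuity and continuity of the maximum then follow from compactness. -/
lemma unitInterval.Iic_eq_range_mul (m : unitInterval) :
    Iic m = (fun t : unitInterval => t * m) '' univ := by
  ext a
  simp only [mem_Iic, image_univ, mem_range]
  constructor
  · intro h
    have h' : (a : ℝ) ≤ m := h
    rcases eq_or_lt_of_le m.2.1 with h0 | h0
    · refine ⟨0, Subtype.ext ?_⟩
      simpa using le_antisymm a.2.1 (h'.trans h0.ge)
    · refine ⟨⟨a / m, div_nonneg a.2.1 m.2.1, (div_le_one h0).2 h'⟩, Subtype.ext ?_⟩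
      exact div_mul_cancel₀ _ h0.ne'
  · rintro ⟨t, rfl⟩
    exact unitInterval.mul_le_right

section Interval

variable {S : Type*} [TopologicalSpace S] {m : S → unitInterval}

lemma upperHemicontinuous_Iic_unitInterval (hm : Continuous m) :
    UpperHemicontinuous fun s => Iic (m s) := by
  refine UpperHemicontinuous.of_forall_isOpen fun s u hu h => ?_
  simp only [unitInterval.Iic_eq_range_mul, image_subset_iff] at h ⊢
  refine isCompact_univ.eventually_forall_of_forall_eventually
    (P := fun s' t => t * m s' ∈ u) fun t ht => ?_
  have hc : Continuous fun q : S × unitInterval => q.2 * m q.1 :=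
    continuous_snd.mul (hm.comp continuous_fst)
  exact hc.continuousAt.eventually (hu.mem_nhds (h ht))

lemma lowerHemicontinuous_Iic_unitInterval (hm : Continuous m) :
    LowerHemicontinuous fun s => Iic (m s) := by
  intro s
  rw [← LowerHemicontinuousAt, lowerHemicontinuousAt_iff]
  rintro u hu ⟨a, ha, hau⟩
  simp only [unitInterval.Iic_eq_range_mul] at ha ⊢
  obtain ⟨t, ht, rfl⟩ := ha
  have hc : Continuous fun s => t * m s := continuous_const.mul hm
  filter_upwards [hc.continuousAt.eventually (hu.mem_nhds hau)] with s' hs'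
  exact ⟨_, mem_image_of_mem _ ht, hs'⟩

lemma continuous_sSup_image_Iic {f : S → unitInterval → ℝ} (hf : Continuous (Function.uncurry f))
    (hm : Continuous m) : Continuous fun s => sSup (f s '' Iic (m s)) := by
  simp only [unitInterval.Iic_eq_range_mul, image_image]
  exact isCompact_univ.continuous_sSup (f := fun s t => f s (t * m s))
    (hf.comp (continuous_fst.prodMk (continuous_snd.mul (hm.comp continuous_fst))))

/-- The smallest maximizer of a continuous function over `[0, m s]` is Borel measurable in `s`. -/
lemma exists_measurable_argmax_Iic [MeasurableSpace S] [BorelSpace S]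
    {f : S → unitInterval → ℝ} (hf : Continuous (Function.uncurry f)) (hm : Continuous m) :
    ∃ σ : S → unitInterval, Measurable σ ∧
      ∀ s, σ s ≤ m s ∧ f s (σ s) = sSup (f s '' Iic (m s)) := by
  have hfs (s : S) : Continuous (f s) := hf.comp (continuous_const.prodMk continuous_id)
  have hmax (s : S) (c : unitInterval) :
      ∃ a ≤ c, f s a = sSup (f s '' Iic c) := by
    obtain ⟨a, ha, h⟩ := isClosed_Iic.isCompact.exists_sSup_image_eq (s := Iic c)
      ⟨c, self_mem_Iic⟩ (hfs s).continuousOn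
    exact ⟨a, ha, h.symm⟩
  have hle (s : S) {c a : unitInterval} (ha : a ≤ c) : f s a ≤ sSup (f s '' Iic c) :=
    le_csSup (isClosed_Iic.isCompact.image (hfs s)).bddAbove (mem_image_of_mem _ ha)
  have hleast (s : S) : ∃ a, IsLeast {a | a ≤ m s ∧ f s a = sSup (f s '' Iic (m s))} a :=
    (isClosed_Iic.inter (isClosed_eq (hfs s) continuous_const)).isCompact.exists_isLeast
      (hmax s (m s))
  choose σ hσ using hleast
  refine ⟨σ, measurable_of_Iic fun c => ?_, fun s => (hσ s).1⟩
  -- The smallest maximizer is at most c exactly when restricting to actions at most c does not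
  -- lower the maximum. Both maxima are continuous in s, so this set is closed.
  have hset : σ ⁻¹' Iic c =
      {s | sSup (f s '' Iic (min c (m s))) = sSup (f s '' Iic (m s))} := by
    ext s
    constructor
    · intro hs
      refine le_antisymm ?_ ?_
      · obtain ⟨a, ha, h⟩ := hmax s (min c (m s))
        rw [← h]
        exact hle s (ha.trans (min_le_right _ _))
      · rw [← (hσ s).1.2]
        exact hle s (le_min hs (hσ s).1.1)
    · intro hs
      obtain ⟨a, ha, h⟩ := hmax s (min c (m s))
      exact ((hσ s).2 ⟨ha.trans (min_le_right _ _), h.trans hs⟩).trans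
        (ha.trans (min_le_left _ _))
  rw [hset]
  exact (isClosed_eq (continuous_sSup_image_Iic hf (continuous_const.min hm))
    (continuous_sSup_image_Iic hf hm)).measurableSet

end Interval

/-! ### Feller kernels and parametric integrals -/

/-- A Feller kernel integrates a jointly continuous bounded function to a jointly continuous one. No
separability of the exogenous state space is needed. -/
lemma Feller.continuous_integral_prod {X Z : Type*} [MetricSpace X] [ProperSpace X]
    [MetricSpace Z] [MeasurableSpace Z] [BorelSpace Z] {Q : Kernel Z Z} [IsMarkovKernel Q]
    (hQ : Feller Q) {v : X × Z → ℝ} (hv : v ∈ bc (X × Z)) :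
    Continuous fun q : X × Z => ∫ z', v (q.1, z') ∂(Q q.2) := by
  obtain ⟨hvc, C, hC⟩ := hv
  have hslice (a : X) : (fun z => v (a, z)) ∈ bc Z :=
    ⟨hvc.comp (continuous_const.prodMk continuous_id), C, fun z => hC _⟩
  have hint {f : Z → ℝ} (hf : f ∈ bc Z) (z : Z) : Integrable f (Q z) := by
    obtain ⟨c, hc⟩ := hf.2
    exact Integrable.of_bound hf.1.measurable.aestronglyMeasurable c
      (Eventually.of_forall hc)
  rw [continuous_iff_continuousAt]
  rintro ⟨a, z⟩
  -- The oscillation of v(·, z') on the δ-ball about a. The ball is compact because X is proper, so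
  -- `osc δ` is itself in bc and the Feller property applies to it.
  set osc : ℝ → Z → ℝ := fun δ z' =>
    sSup ((fun a' => |v (a', z') - v (a, z')|) '' Metric.closedBall a δ) with hosc
  have hdiff (z' : Z) : Continuous fun a' => |v (a', z') - v (a, z')| := by fun_prop
  have hosc_ge {δ : ℝ} {a' : X} (ha' : a' ∈ Metric.closedBall a δ) (z' : Z) :
      |v (a', z') - v (a, z')| ≤ osc δ z' :=
    le_csSup ((isCompact_closedBall a δ).image (hdiff z')).bddAbove
      (mem_image_of_mem (fun a' => |v (a', z') - v (a, z')|) ha')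
  have hosc0 {δ : ℝ} (z' : Z) : 0 ≤ osc δ z' :=
    Real.sSup_nonneg (by rintro _ ⟨a', -, rfl⟩; exact abs_nonneg _)
  have hosc_bc (δ : ℝ) : osc δ ∈ bc Z := by
    refine ⟨(isCompact_closedBall a δ).continuous_sSup
      (f := fun z' a' => |v (a', z') - v (a, z')|) (by fun_prop), 2 * |C|, fun z' => ?_⟩
    rw [abs_of_nonneg (hosc0 z')]
    refine Real.sSup_le ?_ (by positivity)
    rintro _ ⟨a', -, rfl⟩
    have h1 := abs_sub (v (a', z')) (v (a, z'))
    linarith [hC (a', z'), hC (a, z'), le_abs_self C]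
  -- Dominated convergence: the oscillation tends to 0 at each z' by continuity, and `osc 1`
  -- dominates.
  have hosc_lim : Tendsto (fun n : ℕ => ∫ z', osc (1 / ((n : ℝ) + 1)) z' ∂(Q z)) atTop (𝓝 0) := by
    obtain ⟨c, hc⟩ := (hosc_bc 1).2
    have h := tendsto_integral_of_dominated_convergence (μ := Q z)
      (F := fun (n : ℕ) z' => osc (1 / ((n : ℝ) + 1)) z') (f := fun _ => (0 : ℝ)) (osc 1)
      (fun n => (hosc_bc _).1.measurable.aestronglyMeasurable) (hint (hosc_bc 1) z)
      (fun n => Eventually.of_forall fun z' => ?_) (Eventually.of_forall fun z' => ?_)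
    · simpa using h
    · rw [Real.norm_of_nonneg (hosc0 z')]
      refine Real.sSup_le ?_ (hosc0 z')
      rintro _ ⟨a', ha', rfl⟩
      refine hosc_ge (Metric.closedBall_subset_closedBall ?_ ha') z'
      rw [div_le_one (by positivity)]
      linarith [Nat.cast_nonneg (α := ℝ) n]
    · rw [Metric.tendsto_atTop]
      intro ε hε
      have h0 : Tendsto (fun a' => |v (a', z') - v (a, z')|) (𝓝 a) (𝓝 0) := by
        simpa using (hdiff z').tendsto a
      obtain ⟨δ, hδ, hball⟩ := Metric.eventually_nhds_iff_ball.1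
        (h0.eventually (gt_mem_nhds (half_pos hε)))
      obtain ⟨N, hN⟩ := exists_nat_one_div_lt hδ
      refine ⟨N, fun n hn => ?_⟩
      rw [dist_zero_right, Real.norm_of_nonneg (hosc0 z')]
      refine lt_of_le_of_lt (Real.sSup_le ?_ (half_pos hε).le) (half_lt_self hε)
      rintro _ ⟨a', ha', rfl⟩
      refine (hball a' ?_).le
      rw [Metric.mem_closedBall] at ha'
      rw [Metric.mem_ball]
      exact (ha'.trans (Nat.one_div_le_one_div hn)).trans_lt hN
  rw [Metric.continuousAt_iff']
  intro ε hε
  obtain ⟨n, hn⟩ := (hosc_lim.eventually (gt_mem_nhds (half_pos hε))).exists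
  set δ : ℝ := 1 / ((n : ℝ) + 1) with hδ
  have hδ0 : 0 < δ := by positivity
  have h1 : ∀ᶠ z₁ in 𝓝 z, ∫ z', osc δ z' ∂(Q z₁) < ε / 2 :=
    (hQ _ (hosc_bc δ)).1.continuousAt.eventually (gt_mem_nhds hn)
  have h2 : ∀ᶠ z₁ in 𝓝 z, |∫ z', v (a, z') ∂(Q z₁) - ∫ z', v (a, z') ∂(Q z)| < ε / 2 :=
    Metric.continuousAt_iff'.1 (hQ _ (hslice a)).1.continuousAt _ (half_pos hε)
  filter_upwards [prod_mem_nhds (Metric.closedBall_mem_nhds a hδ0) (h1.and h2)]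
  rintro ⟨a₁, z₁⟩ ⟨ha₁, hz₁, hz₁'⟩
  -- The change of action costs at most the integral of `osc δ` under Q(z₁), small for z₁ near z by
  -- `h1`; the change of kernel at fixed a is `h2`.
  have h3 : |∫ z', v (a₁, z') ∂(Q z₁) - ∫ z', v (a, z') ∂(Q z₁)| ≤ ∫ z', osc δ z' ∂(Q z₁) := by
    rw [← integral_sub (hint (hslice a₁) z₁) (hint (hslice a) z₁)]
    exact abs_integral_le_integral_abs.trans (integral_mono
      ((hint (hslice a₁) z₁).sub (hint (hslice a) z₁)).abs (hint (hosc_bc δ) z₁)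
      fun z' => hosc_ge ha₁ z')
  rw [Real.dist_eq]
  have h4 := abs_sub_le (∫ z', v (a₁, z') ∂(Q z₁)) (∫ z', v (a, z') ∂(Q z₁))
    (∫ z', v (a, z') ∂(Q z))
  dsimp only at hz₁ hz₁' ⊢
  linarith

/-! ### The Epstein-Zin aggregator -/

/-- Minkowski's inequality with exponent 1/θ ≥ 1 for the vectors (A^θ, B^θ s) and (0, B^θ (t - s)).
The second has norm B^θ (t - s). -/
lemma ces_le_add {A B θ s t : ℝ} (hA : 0 ≤ A) (hB : 0 ≤ B) (hθ0 : 0 < θ) (hθ1 : θ ≤ 1)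
    (hs : 0 ≤ s) (hst : s ≤ t) :
    (A + B * t ^ (1 / θ)) ^ θ ≤ (A + B * s ^ (1 / θ)) ^ θ + B ^ θ * (t - s) := by
  have hθ : θ * (1 / θ) = 1 := mul_one_div_cancel hθ0.ne'
  have hBθ : 0 ≤ B ^ θ := Real.rpow_nonneg hB θ
  have key := Real.Lp_add_le_of_nonneg (s := Finset.univ) (f := ![A ^ θ, B ^ θ * s])
    (g := ![0, B ^ θ * (t - s)]) (p := 1 / θ) ((one_le_div hθ0).2 hθ1)
    (by
      intro i _
      fin_cases i
      · exact Real.rpow_nonneg hA θ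
      · exact mul_nonneg hBθ hs)
    (by
      intro i _
      fin_cases i
      · exact le_rfl
      · exact mul_nonneg hBθ (sub_nonneg.2 hst))
  have hpow {x u : ℝ} (hx : 0 ≤ x) (hu : 0 ≤ u) :
      (x ^ θ * u) ^ (1 / θ) = x * u ^ (1 / θ) := by
    rw [Real.mul_rpow (Real.rpow_nonneg hx θ) hu, ← Real.rpow_mul hx, hθ, Real.rpow_one]
  have hAθ : (A ^ θ) ^ (1 / θ) = A := by rw [← Real.rpow_mul hA, hθ, Real.rpow_one]
  have hadd : B ^ θ * s + B ^ θ * (t - s) = B ^ θ * t := by ring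
  simp only [Fin.sum_univ_two, Matrix.cons_val_zero, Matrix.cons_val_one, add_zero, hadd] at key
  rw [Real.zero_rpow (one_div_pos.2 hθ0).ne', zero_add, hAθ, hpow hB hs, hpow hB (hs.trans hst),
    one_div_one_div, ← Real.rpow_mul (mul_nonneg hBθ (sub_nonneg.2 hst)),
    one_div_mul_cancel hθ0.ne',
    Real.rpow_one] at key
  exact key

/-- The positive part is 1-Lipschitz, so the constant B^θ survives for arguments of either sign. -/
lemma abs_ces_sub_le {A B θ : ℝ} (hA : 0 ≤ A) (hB : 0 ≤ B) (hθ0 : 0 < θ) (hθ1 : θ ≤ 1)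
    (s t : ℝ) :
    |(A + B * max 0 s ^ (1 / θ)) ^ θ - (A + B * max 0 t ^ (1 / θ)) ^ θ| ≤ B ^ θ * |s - t| := by
  have hBθ : 0 ≤ B ^ θ := Real.rpow_nonneg hB θ
  wlog hst : s ≤ t generalizing s t
  · rw [abs_sub_comm, abs_sub_comm s]
    exact this t s (le_of_not_ge hst)
  have hmax : max 0 s ≤ max 0 t := max_le_max le_rfl hst
  have h1 := ces_le_add hA hB hθ0 hθ1 (le_max_left 0 s) hmax
  have h2 : (A + B * max 0 s ^ (1 / θ)) ^ θ ≤ (A + B * max 0 t ^ (1 / θ)) ^ θ := by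
    have := (one_div_pos.2 hθ0).le
    gcongr
  have h3 : max 0 t - max 0 s ≤ |s - t| := by
    have := abs_max_sub_max_le_abs t s 0
    rw [max_comm t, max_comm s, abs_sub_comm t] at this
    exact (le_abs_self _).trans this
  rw [abs_sub_comm, abs_of_nonneg (sub_nonneg.2 h2)]
  nlinarith [mul_le_mul_of_nonneg_left h3 hBθ]

lemma integrable_of_mem_bm {X Z : Type*} [MeasurableSpace X] [MeasurableSpace Z] {Q : Kernel Z Z}
    [IsMarkovKernel Q] {v : X × Z → ℝ} (hv : v ∈ bm (X × Z)) (a : X) (z : Z) :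
    Integrable (fun z' => v (a, z')) (Q z) := by
  obtain ⟨hm, c, hc⟩ := hv
  exact Integrable.of_bound (hm.comp measurable_prodMk_left).aestronglyMeasurable c
    (Eventually.of_forall fun z' => hc _)

/-- The largest feasible asset holding. -/
noncomputable def ezMaxHolding {Z : Type*} (d p : Z → ℝ) (hdp : ∀ z, 0 ≤ d z + p z)
    (hp0 : ∀ z, 0 < p z) (s : unitInterval × Z) : unitInterval :=
  ⟨min 1 ((d s.2 * (s.1 : ℝ) + p s.2 * (s.1 : ℝ)) / p s.2),
    le_min zero_le_one (div_nonneg (by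
      rw [← add_mul]
      exact mul_nonneg (hdp _) s.1.2.1) (hp0 _).le), min_le_left _ _⟩

lemma continuous_ezMaxHolding {Z : Type*} [TopologicalSpace Z] {d p : Z → ℝ}
    (hdp : ∀ z, 0 ≤ d z + p z) (hp0 : ∀ z, 0 < p z) (hd : Continuous d) (hp : Continuous p) :
    Continuous (ezMaxHolding d p hdp hp0) := by
  refine Continuous.subtype_mk (continuous_const.min (Continuous.div ?_ ?_ fun s => (hp0 _).ne')) _
  all_goals fun_prop

lemma continuous_ezConsumption {Z : Type*} [TopologicalSpace Z] {d p : Z → ℝ} (hd : Continuous d)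
    (hp : Continuous p) :
    Continuous fun g : (unitInterval × Z) × unitInterval => ezConsumption d p g.1 g.2 := by
  unfold ezConsumption
  fun_prop

section EpsteinZin

variable {Z : Type*} [MetricSpace Z] [MeasurableSpace Z] [BorelSpace Z]
  {Q : Kernel Z Z} {ρ γ : ℝ} {d p β : Z → ℝ}

lemma ezProgram_Γ (hdp : ∀ z, 0 ≤ d z + p z) (hp0 : ∀ z, 0 < p z) :
    (ezProgram Q ρ γ d p β).Γ = fun s => Iic (ezMaxHolding d p hdp hp0 s) := by
  funext s
  ext a
  exact ⟨fun h => h.2, fun h => ⟨a.2.1, h⟩⟩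

/-- The upper bound on a is the budget constraint p a ≤ d x + p x; it keeps the base of the real
power nonnegative. -/
lemma ezConsumption_nonneg (hp0 : ∀ z, 0 < p z) {s : unitInterval × Z} {a : unitInterval}
    (ha : a ∈ (ezProgram Q ρ γ d p β).Γ s) : 0 ≤ ezConsumption d p s a := by
  have h := (le_div_iff₀ (hp0 s.2)).1 (ha.2.trans (min_le_right _ _))
  unfold ezConsumption
  linarith

lemma ezProgram_H_nonneg (hp0 : ∀ z, 0 < p z) (hβ0 : ∀ z, 0 ≤ β z) {s : unitInterval × Z}
    {a : unitInterval} (ha : a ∈ (ezProgram Q ρ γ d p β).Γ s) (v : unitInterval × Z → ℝ) :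
    0 ≤ (ezProgram Q ρ γ d p β).H s a v :=
  Real.rpow_nonneg (add_nonneg (Real.rpow_nonneg (ezConsumption_nonneg hp0 ha) _)
    (mul_nonneg (hβ0 _) (Real.rpow_nonneg (le_max_left _ _) _))) _

lemma continuous_ezProgram_H [IsMarkovKernel Q] (hργ : ρ < γ) (hγ : γ < 1) (hd : Continuous d)
    (hp : Continuous p) (hβ : Continuous β) (hQ : Feller Q) {v : unitInterval × Z → ℝ}
    (hv : v ∈ bc (unitInterval × Z)) :
    Continuous fun g : (unitInterval × Z) × unitInterval =>
      (ezProgram Q ρ γ d p β).H g.1 g.2 v := by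
  have h1ρ : 0 ≤ 1 - ρ := by linarith
  have hθ := theta_nonneg hργ hγ
  have hI : Continuous fun g : (unitInterval × Z) × unitInterval =>
      ∫ z', v (g.2, z') ∂(Q g.1.2) :=
    (hQ.continuous_integral_prod hv).comp
      (f := fun g : (unitInterval × Z) × unitInterval => (g.2, g.1.2)) (by fun_prop)
  exact ((((continuous_ezConsumption hd hp).rpow_const fun _ => Or.inr h1ρ).add
    ((hβ.comp (continuous_snd.comp continuous_fst)).mul
      ((continuous_const.max hI).rpow_const fun _ => Or.inr (one_div_nonneg.2 hθ)))).rpow_const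
        fun _ => Or.inr hθ)

lemma measurable_ezProgram_H [IsMarkovKernel Q] (hd : Continuous d)
    (hp : Continuous p) (hβ : Continuous β) {v : unitInterval × Z → ℝ}
    (hv : Measurable v) :
    Measurable fun g : (unitInterval × Z) × unitInterval =>
      (ezProgram Q ρ γ d p β).H g.1 g.2 v := by
  have hI : Measurable fun g : (unitInterval × Z) × unitInterval =>
      ∫ z', v (g.2, z') ∂(Q g.1.2) :=
    (StronglyMeasurable.integral_kernel_prod_right'
      -- Pulling Q back to state-action pairs makes the integral one of a jointly measurable
      -- function against a kernel.
      (κ := Q.comap (fun g : (unitInterval × Z) × unitInterval => g.1.2) (by fun_prop))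
      (f := fun q : ((unitInterval × Z) × unitInterval) × Z => v (q.1.2, q.2))
      (Measurable.stronglyMeasurable (by fun_prop))).measurable
  have hF : Measurable fun g : (unitInterval × Z) × unitInterval => ezConsumption d p g.1 g.2 := by
    have hd' := hd.measurable
    have hp' := hp.measurable
    unfold ezConsumption
    fun_prop
  exact ((hF.pow_const _).add
    ((hβ.measurable.comp (measurable_snd.comp measurable_fst)).mul
      ((measurable_const.max hI).pow_const _))).pow_const _

lemma ezProgram_regular [IsMarkovKernel Q] (hργ : ρ < γ) (hγ : γ < 1)
    (hdp : ∀ z, 0 ≤ d z + p z) (hp0 : ∀ z, 0 < p z)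
    (hd : d ∈ bc Z) (hp : p ∈ bc Z) (hβ : β ∈ bc Z) (hQ : Feller Q) :
    (ezProgram Q ρ γ d p β).Regular where
  candidates := rfl
  upper := by
    rw [ezProgram_Γ hdp hp0]
    exact upperHemicontinuous_Iic_unitInterval (continuous_ezMaxHolding hdp hp0 hd.1 hp.1)
  lower := by
    rw [ezProgram_Γ hdp hp0]
    exact lowerHemicontinuous_Iic_unitInterval (continuous_ezMaxHolding hdp hp0 hd.1 hp.1)
  nonempty s := by
    rw [ezProgram_Γ hdp hp0]
    exact ⟨_, self_mem_Iic⟩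
  compact s := by
    rw [ezProgram_Γ hdp hp0]
    exact isClosed_Iic.isCompact
  measurable v hv := (measurable_ezProgram_H hd.1 hp.1 hβ.1 hv.1).comp measurable_subtype_coe
  continuous v hv :=
    (continuous_ezProgram_H hργ hγ hd.1 hp.1 hβ.1 hQ hv).comp continuous_subtype_val
  bounded := by
    obtain ⟨-, c, hc⟩ := hd
    obtain ⟨-, c', hc'⟩ := hp
    have hθ0 : 0 < (1 - γ) / (1 - ρ) := div_pos (by linarith) (by linarith)
    -- At v = 0 only the consumption term remains, as 0^(1/θ) = 0. Since x ≤ 1 and x - a ≤ 1,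
    -- consumption is at most c + c'.
    refine ⟨0, ⟨continuous_zero, 0, by simp⟩, ((c + c') ^ (1 - ρ)) ^ ((1 - γ) / (1 - ρ)), ?_⟩
    rintro ⟨⟨⟨x, z⟩, a⟩, ha⟩
    have hF0 : 0 ≤ ezConsumption d p (x, z) a :=
      ezConsumption_nonneg (Q := Q) (ρ := ρ) (γ := γ) (β := β) hp0 ha
    have hF : ezConsumption d p (x, z) a ≤ c + c' := by
      have h1 : d z * (x : ℝ) ≤ c :=
        (le_abs_self _).trans (by
          rw [abs_mul, abs_of_nonneg x.2.1]
          exact (mul_le_of_le_one_right (abs_nonneg _) x.2.2).trans (hc z))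
      have h2 : p z * ((x : ℝ) - a) ≤ c' :=
        (mul_le_of_le_one_right (hp0 z).le (by linarith [x.2.2, a.2.1])).trans
          ((le_abs_self _).trans (hc' z))
      exact add_le_add h1 h2
    have hH : (ezProgram Q ρ γ d p β).H (x, z) a 0 =
        (ezConsumption d p (x, z) a ^ (1 - ρ)) ^ ((1 - γ) / (1 - ρ)) := by
      simp only [ezProgram, Pi.zero_apply, integral_zero, max_self]
      rw [Real.zero_rpow (one_div_pos.2 hθ0).ne', mul_zero, add_zero]
    have h1ρ : 0 ≤ 1 - ρ := by linarith
    have hFρ : 0 ≤ ezConsumption d p (x, z) a ^ (1 - ρ) := Real.rpow_nonneg hF0 _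
    change |(ezProgram Q ρ γ d p β).H (x, z) a 0| ≤ _
    rw [hH, abs_of_nonneg (Real.rpow_nonneg hFρ _)]
    exact Real.rpow_le_rpow hFρ (Real.rpow_le_rpow hF0 hF h1ρ) hθ0.le

lemma ezProgram_monotonicity [IsMarkovKernel Q] (hργ : ρ < γ) (hγ : γ < 1)
    (hp0 : ∀ z, 0 < p z) (hβ0 : ∀ z, 0 ≤ β z) :
    (ezProgram Q ρ γ d p β).Monotonicity := by
  intro v hv w hw hvw s a ha
  have hI : ∫ z', v (a, z') ∂(Q s.2) ≤ ∫ z', w (a, z') ∂(Q s.2) :=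
    integral_mono (integrable_of_mem_bm hv a s.2) (integrable_of_mem_bm hw a s.2)
      fun z' => hvw (a, z')
  have hθ := theta_nonneg hργ hγ
  have h1 := max_le_max (le_refl (0 : ℝ)) hI
  refine Real.rpow_le_rpow (add_nonneg (Real.rpow_nonneg (ezConsumption_nonneg hp0 ha) _)
    (mul_nonneg (hβ0 _) (Real.rpow_nonneg (le_max_left _ _) _))) ?_ hθ
  refine add_le_add le_rfl (mul_le_mul_of_nonneg_left ?_ (hβ0 _))
  exact Real.rpow_le_rpow (le_max_left _ _) h1 (one_div_nonneg.2 hθ)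

lemma ezProgram_longRunContractive [IsMarkovKernel Q] (hργ : ρ < γ) (hγ : γ < 1)
    (hp0 : ∀ z, 0 < p z) (hβ0 : ∀ z, 0 ≤ β z) (hβ : β ∈ bc Z)
    (hr : ∃ r : ℝ, HasSpectralRadius
      (discountOp Q (fun z => β z ^ ((1 - γ) / (1 - ρ)))
        (rpow_mem_bm hβ hβ0 (theta_nonneg hργ hγ))) r ∧ r < 1) :
    (ezProgram Q ρ γ d p β).LongRunContractive Q := by
  -- The function b is read off from `hr`: it is β^θ.
  refine ⟨_, _, fun z => Real.rpow_nonneg (hβ0 z) _, fun v hv w hw x z a ha => ?_, hr⟩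
  have hθ0 : 0 < (1 - γ) / (1 - ρ) := div_pos (by linarith) (by linarith)
  have hθ1 : (1 - γ) / (1 - ρ) ≤ 1 := (div_le_one (by linarith)).2 (by linarith)
  have h1 := abs_ces_sub_le (Real.rpow_nonneg (ezConsumption_nonneg hp0 ha) (1 - ρ)) (hβ0 z) hθ0 hθ1
    (∫ z', v (a, z') ∂(Q z)) (∫ z', w (a, z') ∂(Q z))
  refine (ENNReal.ofReal_le_ofReal h1).trans ?_
  rw [ENNReal.ofReal_mul (Real.rpow_nonneg (hβ0 z) _)]
  gcongr
  rw [← integral_sub (integrable_of_mem_bm hv a z) (integrable_of_mem_bm hw a z)]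
  refine (ENNReal.ofReal_le_ofReal abs_integral_le_integral_abs).trans ?_
  rw [ofReal_integral_eq_lintegral_ofReal (f := fun z' => |v (a, z') - w (a, z')|)
    ((integrable_of_mem_bm hv a z).sub (integrable_of_mem_bm hw a z)).abs
    (Eventually.of_forall fun z' => abs_nonneg _)]
  gcongr with z'
  -- The action is the next endogenous state, so x' = a is one term of the supremum.
  exact le_iSup (fun x' : unitInterval => ENNReal.ofReal |v (x', z') - w (x', z')|) a

end EpsteinZin

/-! ### The Epstein-Zin theorem -/

theorem propositionp {Z : Type*} [MetricSpace Z] [MeasurableSpace Z] [BorelSpace Z]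
    (Q : Kernel Z Z) [IsMarkovKernel Q]
    (ρ γ : ℝ) (hργ : ρ < γ) (hγ : γ < 1)
    (d p β : Z → ℝ)
    (hdp : ∀ z, 0 ≤ d z + p z) (hp0 : ∀ z, 0 < p z) (hβ0 : ∀ z, 0 ≤ β z)
    (hd : d ∈ bc Z) (hp : p ∈ bc Z) (hβ : β ∈ bc Z)
    (hr : ∃ r : ℝ, HasSpectralRadius
      (discountOp Q (fun z => β z ^ ((1 - γ) / (1 - ρ)))
        (rpow_mem_bm hβ hβ0 (theta_nonneg hργ hγ))) r ∧ r < 1)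
    (hQ : Feller Q) :
    let D := ezProgram Q ρ γ d p β
    -- the program is regular and satisfies the key assumptions
    D.Regular ∧ D.Monotonicity ∧ D.LongRunContractive Q ∧
    -- the policy operators and the Bellman operator are eventually contracting
    (∀ σ ∈ D.policies, EventuallyContractingOn (D.Tpol σ) (bm (unitInterval × Z))) ∧
    EventuallyContractingOn D.T (bc (unitInterval × Z)) ∧
    -- lifetime values are well defined, bounded and measurable (and nonnegative)
    (∀ σ ∈ D.policies, ∃ w, D.IsPolicyValue σ w ∧ w ∈ bm (unitInterval × Z) ∧ 0 ≤ w) ∧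
    -- the value function is well defined, bounded and continuous (and nonnegative),
    -- and is the unique fixed point of the Bellman operator
    ∃ vs, D.IsValueFunction vs ∧ vs ∈ bc (unitInterval × Z) ∧ 0 ≤ vs ∧
      D.T vs = vs ∧ (∀ w ∈ bc (unitInterval × Z), D.T w = w → w = vs) ∧
      -- an optimal policy exists
      (∃ σ, D.IsOptimal σ) ∧
      -- principle of optimality
      (∀ σ ∈ D.policies, D.IsOptimal σ ↔
        ∀ s, σ s ∈ D.Γ s ∧ IsMaxOn (fun a => D.H s a vs) (D.Γ s) (σ s)) ∧
      -- convergence of Howard's policy iteration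
      (∀ (σ : ℕ → unitInterval × Z → unitInterval) (w : ℕ → unitInterval × Z → ℝ),
        (∀ k, σ k ∈ D.policies) → (∀ k, D.IsPolicyValue (σ k) (w k)) →
        (∀ k, D.Tpol (σ (k + 1)) (w k) = D.T (w k)) →
        TendstoUniformly w vs atTop) := by
  intro D
  have hreg : D.Regular := ezProgram_regular hργ hγ hdp hp0 hd hp hβ hQ
  have hmono : D.Monotonicity := ezProgram_monotonicity hργ hγ hp0 hβ0
  have hlong : D.LongRunContractive Q := ezProgram_longRunContractive hργ hγ hp0 hβ0 hβ hr
  obtain ⟨L, e, hL, hsum⟩ := hlong.exists_dominated hreg.candidates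
  have hΓ : D.Γ = fun s => Iic (ezMaxHolding d p hdp hp0 s) := ezProgram_Γ hdp hp0
  have hm := continuous_ezMaxHolding hdp hp0 hd.1 hp.1
  have hHc {v : unitInterval × Z → ℝ} (hv : v ∈ bc (unitInterval × Z)) :
      Continuous (Function.uncurry fun s a => D.H s a v) :=
    continuous_ezProgram_H hργ hγ hd.1 hp.1 hβ.1 hQ hv
  have hsel : ∀ v ∈ bc (unitInterval × Z), ∃ σ ∈ D.policies, D.Tpol σ v = D.T v := by
    intro v hv
    obtain ⟨σ, hσm, hσ⟩ := exists_measurable_argmax_Iic (hHc hv) hm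
    refine ⟨σ, ⟨hσm, fun s => ?_⟩, funext fun s => ?_⟩
    · rw [hΓ]
      exact (hσ s).1
    · rw [DynamicProgram.T, hΓ]
      exact (hσ s).2
  have hT : MapsTo D.T (bc (unitInterval × Z)) (bc (unitInterval × Z)) := by
    intro v hv
    constructor
    · have h := continuous_sSup_image_Iic (hHc hv) hm
      unfold DynamicProgram.T
      rw [hΓ]
      exact h
    -- T v equals T_σ v for a greedy σ, and T_σ preserves boundedness.
    · obtain ⟨σ, hσ, h⟩ := hsel v hv
      rw [← h]
      exact ((hL.tpol hreg hσ).mapsTo (bc_subset_bm _ hv)).2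
  have hnonneg {σ : unitInterval × Z → unitInterval} (hσ : σ ∈ D.policies)
      {w : unitInterval × Z → ℝ} (hw : D.IsPolicyValue σ w) : 0 ≤ w := by
    -- A policy value is its own image under T_σ, and H is nonnegative at every candidate thanks to
    -- the positive part.
    rw [← (hL.policyValue hreg hsum hσ hw).2]
    exact fun s => ezProgram_H_nonneg hp0 hβ0 (hσ.2 s) w
  obtain ⟨vs, hval, hvs, hfix, huniq, ⟨τ, hτ, hτv⟩, hopt, hhow⟩ :=
    hL.optimality hsum hmono hreg hT hsel
  refine ⟨hreg, hmono, hlong, fun σ hσ => ?_, ?_, fun σ hσ => ?_, vs, hval, hvs, hnonneg hτ hτv,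
    hfix, huniq, ⟨τ, hτ, vs, hτv, hval⟩, hopt, hhow⟩
  · exact (hL.tpol hreg hσ).eventuallyContractingOn (fun _ hv => hv.2) hsum
  · exact (hL.dominatedBy_T hreg hT).eventuallyContractingOn (fun _ hv => hv.2) hsum
  · obtain ⟨w, hw, hwv, -⟩ := hL.exists_policyValue hreg hsum hσ
    exact ⟨w, hwv, hw, hnonneg hσ hwv⟩
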